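/- Let $\Omega\subset\mathbb R^3$ and let $p\in\Omega$ be a point of the $G^2$ region of $\Omega$, i.e. some relatively open neighborhood of $p$ in $\Omega$ is the image of a regular $C^2$ parametrization $\varphi$ (a $C^2$ homeomorphism from an open subset of $\mathbb R^2$ with injective differential). Let $f:\Omega\to\mathbb R$ be of class $C^2$ near $p=\varphi(s_0)$, i.e. $f\circ\varphi$ is $C^2$ near $s_0$. Nothing is assumed on $\Omega$ and $f$ away from $p$. Consider finite meshes of triangles and quadrilaterals with all nodes on $\Omega$; the mesh size is the largest diameter of a cell. At each node $v$, choose a stencil of mesh nodes $x$ with weights $w_x\ge 0$, and let $u_x\in\mathbb R^2$ be the coordinates, in an orthonormal frame with origin $v$, of the orthogonal projection of $x$ onto the tangent plane at $v$ (at nodes away from $p$, outside the image of $\varphi$, any plane through $v$ may be used). Let $q_v$ be the quadratic polynomial on that plane that minimizes $\sum_x w_x^2\,(q(u_x)-f(x))^2$, either over all polynomials $q$ of degree at most $2$, or over those with $q(0)=f(v)$. For a cell $\sigma$ with $m$ nodes and center $x_\sigma=\frac1m\sum_{v\in\sigma}v$, let $$\alpha_\sigma=\frac1m\sum_{v\in\sigma}q_v(u_{x_\sigma})-\frac1m\sum_{v\in\sigma}f(v),$$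 where $u_{x_\sigma}$ denotes the coordinates of the projection of $x_\sigma$ onto the tangent plane at $v$. (a) If $p$ is a local minimum of $f$ on $\Omega$ and the Hessian of $f\circ\varphi$ at $s_0$ is positive definite, then there is a neighborhood $U$ of $p$ such that for all constants $\kappa,\Gamma$ there is an $h_0>0$ with the following property. For every mesh of size less than $h_0$ and every choice of stencils and weights such that, in $U$, - the fittings are stable: at every node $v\in U$ the row-weighted Vandermonde matrix of the fitted monomials, with local coordinates divided by the stencil radius $\max_x|u_x|$, has full column rank and condition number at most $\kappa$; - the stencils are comparable in size to the cells: $|x-v|\le\Gamma\,\mathrm{diam}(\sigma)$ for every cell $\sigma\subset U$, every node $v$ of $\sigma$ and every $x$ in the stencil of $v$; one has $\alpha_\sigma<0$ for every cell $\sigma$ with all its nodes in $U$. (b) If $p$ is a local maximum of $f$ on $\Omega$ and the Hessian of $f\circ\varphi$ at $s_0$ is negative definite, the same holds with $\alpha_\sigma>0$. -/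

import Mathlib

open scoped Topology NNReal

/-- The Euclidean plane. -/
abbrev E2 : Type := EuclideanSpace ℝ (Fin 2)

/-- Euclidean three-space. -/
abbrev E3 : Type := EuclideanSpace ℝ (Fin 3)

/-- A regular `C²` parametrization of a relatively open piece of `Ω ⊆ ℝ³`, as in the classical
definition of a regular surface: a `C²` homeomorphism from an open subset of the plane onto
`Ω ∩ nbhd`, with injective differential.  The `G²` region of `Ω` consists of the points of `Ω` that
lie in the image of such a chart; nothing is required of `Ω` elsewhere. -/
structure G2Chart (Ω : Set E3) where
  toFun : E2 → E3
  source : Set E2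
  isOpen_source : IsOpen source
  nbhd : Set E3
  isOpen_nbhd : IsOpen nbhd
  image_source : toFun '' source = Ω ∩ nbhd
  contDiffOn : ContDiffOn ℝ 2 toFun source
  injective_fderiv : ∀ s ∈ source, Function.Injective (fderiv ℝ toFun s)
  invFun : E3 → E2
  leftInvOn : Set.LeftInvOn invFun toFun source
  continuousOn_invFun : ContinuousOn invFun (Ω ∩ nbhd)

namespace G2Chart

/-- The tangent plane (a linear subspace of `ℝ³`) of the surface at the point with parameter `s`:
the plane orthogonal to the surface normal. -/
noncomputable def tangentPlane {Ω : Set E3} (φ : G2Chart Ω) (s : E2) : Submodule ℝ E3 :=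
  LinearMap.range (fderiv ℝ φ.toFun s : E2 →ₗ[ℝ] E3)

/-- The Hessian quadratic form, in the parameter domain, of a function `f` on the surface. -/
noncomputable def hessian {Ω : Set E3} (φ : G2Chart Ω) (f : E3 → ℝ) (s ξ : E2) : ℝ :=
  fderiv ℝ (fderiv ℝ (f ∘ φ.toFun)) s ξ ξ

end G2Chart

/-- A mesh of triangles and quadrilaterals whose nodes lie on `Ω`.  A cell is recorded by its set of
nodes, which is all that enters the indicator; conformity of the mesh is not imposed. -/
structure SurfaceMesh (Ω : Set E3) where
  cells : Finset (Finset E3)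
  card_cell : ∀ σ ∈ cells, σ.card = 3 ∨ σ.card = 4
  cell_subset : ∀ σ ∈ cells, (σ : Set E3) ⊆ Ω

namespace SurfaceMesh

/-- The nodes of the mesh. -/
def nodes {Ω : Set E3} (M : SurfaceMesh Ω) : Set E3 :=
  {v | ∃ σ ∈ M.cells, v ∈ σ}

/-- The mesh size: the largest diameter of a cell. -/
noncomputable def size {Ω : Set E3} (M : SurfaceMesh Ω) : ℝ :=
  ((M.cells.sup fun σ => (Metric.diam (σ : Set E3)).toNNReal : ℝ≥0) : ℝ)

end SurfaceMesh

/-- The coordinates, in the frame `e`, of the orthogonal projection of `x` onto the plane through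
`v` spanned by `e`, with `v` as origin. -/
noncomputable def localCoord (e : Fin 2 → E3) (v x : E3) : E2 :=
  !₂[inner ℝ (e 0) (x - v), inner ℝ (e 1) (x - v)]

/-- The monomials of degree at most two in two variables. -/
def quadMonomials (u : E2) : Fin 6 → ℝ :=
  ![1, u 0, u 1, u 0 ^ 2, u 0 * u 1, u 1 ^ 2]

/-- The quadratic polynomial with coefficients `c`. -/
def quadEval (c : Fin 6 → ℝ) (u : E2) : ℝ :=
  ∑ k, c k * quadMonomials u k

/-- The largest singular value. -/
noncomputable def sigmaMax {m n : Type*} [Fintype m] [Fintype n] [DecidableEq n]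
    (A : Matrix m n ℝ) : ℝ :=
  sSup ((fun y => ‖Matrix.toEuclideanLin A y‖) '' Metric.sphere (0 : EuclideanSpace ℝ n) 1)

/-- The smallest of the singular values, counted by columns. -/
noncomputable def sigmaMin {m n : Type*} [Fintype m] [Fintype n] [DecidableEq n]
    (A : Matrix m n ℝ) : ℝ :=
  sInf ((fun y => ‖Matrix.toEuclideanLin A y‖) '' Metric.sphere (0 : EuclideanSpace ℝ n) 1)

/-- `A` has full column rank and (spectral) condition number at most `κ`. -/
def CondNumberLE {m n : Type*} [Fintype m] [Fintype n] [DecidableEq n]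
    (A : Matrix m n ℝ) (κ : ℝ) : Prop :=
  0 < sigmaMin A ∧ sigmaMax A / sigmaMin A ≤ κ

/-- Two forms of quadratic fitting: all six coefficients are fitted, or the constant coefficient
is prescribed to be the value at the center, and the other five are fitted. -/
inductive FitKind where
  | free
  | interpolating

/-- The indices of the coefficients that are fitted. -/
def FitKind.columns : FitKind → Finset (Fin 6)
  | .free => Finset.univ
  | .interpolating => Finset.univ.erase 0

/-- The choices behind the local fittings on a mesh: for every node `v`, a stencil of nodes,
nonnegative weights on it, and an orthonormal frame of the plane onto which the stencil is
projected. -/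
structure FittingScheme {Ω : Set E3} (M : SurfaceMesh Ω) where
  kind : FitKind
  stencil : E3 → Finset E3
  stencil_subset : ∀ v ∈ M.nodes, (stencil v : Set E3) ⊆ M.nodes
  weight : E3 → E3 → ℝ
  weight_nonneg : ∀ v x, 0 ≤ weight v x
  frame : E3 → Fin 2 → E3
  orthonormal_frame : ∀ v, Orthonormal ℝ (frame v)

namespace FittingScheme

/-- Local coordinates of `x` at the node `v`. -/
noncomputable def coord {Ω : Set E3} {M : SurfaceMesh Ω} (S : FittingScheme M) (v x : E3) : E2 :=
  localCoord (S.frame v) v x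

/-- The radius of the projected stencil of `v`. -/
noncomputable def stencilRadius {Ω : Set E3} {M : SurfaceMesh Ω} (S : FittingScheme M)
    (v : E3) : ℝ :=
  (((S.stencil v).sup fun x => ‖S.coord v x‖₊ : ℝ≥0) : ℝ)

/-- The matrix of the weighted least squares problem at `v`, with the local coordinates scaled by
the radius of the stencil: the scaled Vandermonde matrix, with its rows weighted. -/
noncomputable def scaledVandermonde {Ω : Set E3} {M : SurfaceMesh Ω} (S : FittingScheme M)
    (v : E3) : Matrix {x // x ∈ S.stencil v} {k // k ∈ S.kind.columns} ℝ :=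
  Matrix.of fun x k =>
    S.weight v x * quadMonomials ((S.stencilRadius v)⁻¹ • S.coord v x) k

/-- The squared weighted residual at `v` of the polynomial with coefficients `c`. -/
noncomputable def residual {Ω : Set E3} {M : SurfaceMesh Ω} (S : FittingScheme M) (f : E3 → ℝ)
    (v : E3) (c : Fin 6 → ℝ) : ℝ :=
  ∑ x ∈ S.stencil v, (S.weight v x * (quadEval c (S.coord v x) - f x)) ^ 2

/-- The coefficient vectors over which the residual at `v` is minimized. -/
def admissible {Ω : Set E3} {M : SurfaceMesh Ω} (S : FittingScheme M) (f : E3 → ℝ)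
    (v : E3) : Set (Fin 6 → ℝ) :=
  {c | S.kind = FitKind.interpolating → c 0 = f v}

/-- `c` holds the coefficients of the quadratic weighted least squares fitting of `f` at `v`. -/
def IsWLSFit {Ω : Set E3} {M : SurfaceMesh Ω} (S : FittingScheme M) (f : E3 → ℝ)
    (v : E3) (c : Fin 6 → ℝ) : Prop :=
  c ∈ S.admissible f v ∧ IsMinOn (S.residual f v) (S.admissible f v) c

/-- On `U`, the planes of projection are the tangent planes of the surface. -/
def TangentialOn {Ω : Set E3} {M : SurfaceMesh Ω} (S : FittingScheme M) (φ : G2Chart Ω)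
    (U : Set E3) : Prop :=
  ∀ s ∈ φ.source, φ.toFun s ∈ M.nodes → φ.toFun s ∈ U →
    ∀ i, S.frame (φ.toFun s) i ∈ φ.tangentPlane s

/-- On `U`, the local fittings are stable, with bound `κ` for the condition numbers. -/
def StableOn {Ω : Set E3} {M : SurfaceMesh Ω} (S : FittingScheme M) (κ : ℝ) (U : Set E3) : Prop :=
  ∀ v ∈ M.nodes, v ∈ U → CondNumberLE (S.scaledVandermonde v) κ

/-- On `U`, the stencils of the nodes of a cell have a size comparable to that of the cell.  This
is so if the cells have diameters of the same order and the stencils are rings of bounded order. -/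
def ComparableOn {Ω : Set E3} {M : SurfaceMesh Ω} (S : FittingScheme M) (Γ : ℝ)
    (U : Set E3) : Prop :=
  ∀ σ ∈ M.cells, (σ : Set E3) ⊆ U → ∀ v ∈ σ, ∀ x ∈ S.stencil v,
    dist x v ≤ Γ * Metric.diam (σ : Set E3)

end FittingScheme

/-- The cell center: the average of the nodes. -/
noncomputable def cellCenter (σ : Finset E3) : E3 :=
  (σ.card : ℝ)⁻¹ • ∑ v ∈ σ, v

/-- Linear (or bilinear) interpolation of `f` at the cell center. -/
noncomputable def linearValue (f : E3 → ℝ) (σ : Finset E3) : ℝ :=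
  (σ.card : ℝ)⁻¹ * ∑ v ∈ σ, f v

/-- The weighted average of local fittings at the cell center; `c v` holds the coefficients of the
local fitting at the node `v`. -/
noncomputable def walfValue {Ω : Set E3} {M : SurfaceMesh Ω} (S : FittingScheme M)
    (c : E3 → Fin 6 → ℝ) (σ : Finset E3) : ℝ :=
  (σ.card : ℝ)⁻¹ * ∑ v ∈ σ, quadEval (c v) (S.coord v (cellCenter σ))

/-- The overshoot-undershoot indicator `α_σ`. -/
noncomputable def osus {Ω : Set E3} {M : SurfaceMesh Ω} (S : FittingScheme M) (f : E3 → ℝ)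
    (c : E3 → Fin 6 → ℝ) (σ : Finset E3) : ℝ :=
  walfValue S c σ - linearValue f σ

/-- Near `p`, on sufficiently fine meshes, all the indicators `α_σ` satisfy `P`: there is a
neighborhood `U` of `p` such that for all bounds `κ` and `Γ` there is a threshold for the mesh size
below which `P α_σ` holds for all cells `σ` in `U`, whatever the mesh and the fitting scheme, so
long as the scheme projects to the tangent planes, is stable with bound `κ` and has stencils
comparable to the cells with bound `Γ`. -/
def OsusNear {Ω : Set E3} (φ : G2Chart Ω) (f : E3 → ℝ) (p : E3) (P : ℝ → Prop) : Prop :=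
  ∃ U ∈ 𝓝 p, ∀ κ Γ : ℝ, ∃ h₀ > 0, ∀ M : SurfaceMesh Ω, M.size < h₀ →
    ∀ S : FittingScheme M, S.TangentialOn φ U → S.StableOn κ U → S.ComparableOn Γ U →
      ∀ c : E3 → Fin 6 → ℝ, (∀ v ∈ M.nodes, S.IsWLSFit f v (c v)) →
        ∀ σ ∈ M.cells, (σ : Set E3) ⊆ U → P (osus S f c σ)

/-! Fix a node `v = φ s` near `p` and let `A` be the pseudo-inverse of the differential of the chart
at `s`. In the coordinate `y = A (x - v)` one has `f x = f v + l y + K y y + o(‖y‖²)`, uniformly in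
`v`. Here `K` is half the Hessian plus a curvature correction linear in the gradient. The correction
vanishes at `p`, so `K` is uniformly positive definite nearby (`G2Chart.exists_uniform_expansion`).

As `A` annihilates the normal direction, this expansion is a quadratic polynomial in the tangent
coordinates. Its constant term is `f v`, so it is admissible for both kinds of fitting, and
stability forces the fitted polynomial to differ from it by only `O(ε h²)` at the center of a cell
of diameter `h` (`FittingScheme.IsWLSFit.abs_sub_le`). The center is the mean of the nodes, so
against the mean nodal value the linear part cancels exactly, whatever its size. Convexity leaves a
gap of order `h²` (`mean_sub_apply_mean_ge`, `quadratic_cellCenter_le`), which needs no shape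
regularity of the cell.

For small `ε` the gap wins at each node separately, hence also on average. The radius and constants
of the expansion are fixed before `ε`, so `U` does not depend on `κ` and `Γ`. The case of a maximum
follows by replacing `f` with `-f`. -/

set_option maxSynthPendingDepth 3

/-! ### Second-order Taylor estimates -/

section Taylor

variable {E F : Type*} [NormedAddCommGroup E] [NormedSpace ℝ E] [NormedAddCommGroup F]
  [NormedSpace ℝ F]

/-- Taylor's inequality of order two on a segment. -/
theorem norm_sub_taylor_two_le {g : E → F} {W : Set E} (hW : IsOpen W) (hg : ContDiffOn ℝ 2 g W)
    {s t : E} (hst : segment ℝ s t ⊆ W) {ε : ℝ}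
    (hε : ∀ z ∈ segment ℝ s t, ‖fderiv ℝ (fderiv ℝ g) z - fderiv ℝ (fderiv ℝ g) s‖ ≤ ε) :
    ‖g t - g s - fderiv ℝ g s (t - s) - (2⁻¹ : ℝ) • fderiv ℝ (fderiv ℝ g) s (t - s) (t - s)‖
      ≤ ε * ‖t - s‖ ^ 2 := by
  have hs : s ∈ segment ℝ s t := left_mem_segment ℝ s t
  have hε0 : 0 ≤ ε := (ContinuousLinearMap.opNorm_nonneg _).trans (hε s hs)
  have hat : ∀ z ∈ segment ℝ s t, ContDiffAt ℝ 2 g z := fun z hz =>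
    hg.contDiffAt (hW.mem_nhds (hst hz))
  have hd1 : ∀ z ∈ segment ℝ s t, HasFDerivAt g (fderiv ℝ g z) z := fun z hz =>
    ((hat z hz).differentiableAt (by norm_num)).hasFDerivAt
  have hd2 : ∀ z ∈ segment ℝ s t,
      HasFDerivAt (fderiv ℝ g) (fderiv ℝ (fderiv ℝ g) z) z := fun z hz =>
    (((hat z hz).fderiv_right (m := 1) (by norm_num)).differentiableAt (by norm_num)).hasFDerivAt
  have hc := convex_segment (𝕜 := ℝ) s t
  set B := fderiv ℝ (fderiv ℝ g) s with hB
  -- Mean value inequality for the first differential.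
  have hfirst : ∀ z ∈ segment ℝ s t,
      ‖fderiv ℝ g z - fderiv ℝ g s - B (z - s)‖ ≤ ε * ‖t - s‖ := by
    intro z hz
    refine (hc.norm_image_sub_le_of_norm_hasFDerivWithin_le'
      (fun y hy => (hd2 y hy).hasFDerivWithinAt) hε hs hz).trans ?_
    gcongr
    obtain ⟨r, hr, rfl⟩ := (segment_eq_image' ℝ s t ▸ hz : z ∈ _ '' _)
    simp only [add_sub_cancel_left, norm_smul, Real.norm_eq_abs, abs_of_nonneg hr.1]
    exact mul_le_of_le_one_left (norm_nonneg _) hr.2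
  -- Along the segment, the derivative of the second-order remainder is the remainder bounded in
  -- `hfirst`, applied to `t - s`.
  have hder : ∀ r ∈ Set.Icc (0 : ℝ) 1, HasDerivWithinAt
      (fun r : ℝ => g (s + r • (t - s)) - r • fderiv ℝ g s (t - s)
        - (r ^ 2 / 2) • B (t - s) (t - s))
      ((fderiv ℝ g (s + r • (t - s)) - fderiv ℝ g s - B (s + r • (t - s) - s)) (t - s))
      (Set.Icc 0 1) r := by
    intro r hr
    have hz : s + r • (t - s) ∈ segment ℝ s t := by
      rw [segment_eq_image']; exact ⟨r, hr, rfl⟩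
    have h1 : HasDerivAt (fun r : ℝ => s + r • (t - s)) ((1 : ℝ) • (t - s)) r :=
      ((hasDerivAt_id r).smul_const (t - s)).const_add s
    have h2 := (hd1 _ hz).comp_hasDerivAt r h1
    have h3 : HasDerivAt (fun r : ℝ => r • fderiv ℝ g s (t - s))
      ((1 : ℝ) • fderiv ℝ g s (t - s)) r := (hasDerivAt_id r).smul_const _
    have h4 : HasDerivAt (fun r : ℝ => (r ^ 2 / 2) • B (t - s) (t - s))
      (r • B (t - s) (t - s)) r := by
      have : HasDerivAt (fun r : ℝ => r ^ 2 / 2) r r := by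
        simpa using (hasDerivAt_pow 2 r).div_const 2
      exact this.smul_const _
    refine (((h2.sub h3).sub h4).hasDerivWithinAt).congr_deriv ?_
    simp
  have key := norm_image_sub_le_of_norm_deriv_le_segment_01' hder (C := ε * ‖t - s‖ ^ 2) ?_
  · convert key using 2
    simp
    abel
  · intro r hr
    have hz : s + r • (t - s) ∈ segment ℝ s t := by
      rw [segment_eq_image']; exact ⟨r, Set.Ico_subset_Icc_self hr, rfl⟩
    refine (ContinuousLinearMap.le_opNorm _ _).trans ?_
    calc _ ≤ (ε * ‖t - s‖) * ‖t - s‖ := by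
          gcongr
          exact hfirst _ hz
      _ = _ := by ring

theorem continuousOn_fderiv_fderiv {g : E → F} {W : Set E} (hW : IsOpen W)
    (hg : ContDiffOn ℝ 2 g W) : ContinuousOn (fderiv ℝ (fderiv ℝ g)) W :=
  (hg.fderiv_of_isOpen (m := 1) hW (by norm_num)).continuousOn_fderiv_of_isOpen hW le_rfl

/-- Taylor's inequality of order two holds uniformly on compact convex sets. -/
theorem exists_norm_sub_taylor_two_le {g : E → F} {W D : Set E} (hW : IsOpen W)
    (hg : ContDiffOn ℝ 2 g W) (hDW : D ⊆ W) (hD : IsCompact D) (hDc : Convex ℝ D)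
    {ε : ℝ} (hε : 0 < ε) :
    ∃ δ > 0, ∀ s ∈ D, ∀ t ∈ D, ‖t - s‖ < δ →
      ‖g t - g s - fderiv ℝ g s (t - s) - (2⁻¹ : ℝ) • fderiv ℝ (fderiv ℝ g) s (t - s) (t - s)‖
        ≤ ε * ‖t - s‖ ^ 2 := by
  have hu := hD.uniformContinuousOn_of_continuous ((continuousOn_fderiv_fderiv hW hg).mono hDW)
  obtain ⟨δ, hδ, h⟩ := (Metric.uniformContinuousOn_iff (β := E →L[ℝ] E →L[ℝ] F)).1 hu ε hε
  refine ⟨δ, hδ, fun s hs t ht hst => ?_⟩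
  have hseg := hDc.segment_subset hs ht
  refine norm_sub_taylor_two_le hW hg (hseg.trans hDW) fun z hz => ?_
  refine (dist_eq_norm (fderiv ℝ (fderiv ℝ g) z) (fderiv ℝ (fderiv ℝ g) s)).symm.trans_le
    (h z (hseg hz) s hs ?_).le
  obtain ⟨r, hr, rfl⟩ := (segment_eq_image' ℝ s t ▸ hz : z ∈ _ '' _)
  rw [dist_eq_norm, add_sub_cancel_left, norm_smul, Real.norm_eq_abs, abs_of_nonneg hr.1]
  exact (mul_le_of_le_one_left (norm_nonneg _) hr.2).trans_lt hst

end Taylor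

/-! ### The pseudo-inverse of the differential -/

section PseudoInverse

variable {E F : Type*} [NormedAddCommGroup E] [InnerProductSpace ℝ E] [CompleteSpace E]
  [NormedAddCommGroup F] [InnerProductSpace ℝ F] [CompleteSpace F]

/-- The Moore-Penrose inverse of an injective linear map. -/
noncomputable def leftPseudoInverse (L : E →L[ℝ] F) : F →L[ℝ] E :=
  (Ring.inverse (ContinuousLinearMap.adjoint L ∘L L)) ∘L ContinuousLinearMap.adjoint L

/-- Since `⟪L* L x, x⟫ = ‖L x‖²`, the kernel is trivial, which suffices in finite dimension. -/
theorem isUnit_adjoint_comp_self [FiniteDimensional ℝ E] {L : E →L[ℝ] F} (hL : Function.Injective L) :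
    IsUnit (ContinuousLinearMap.adjoint L ∘L L) := by
  have hinj : Function.Injective (ContinuousLinearMap.adjoint L ∘L L) := by
    rw [injective_iff_map_eq_zero]
    intro x hx
    have : ‖L x‖ ^ 2 = 0 := by
      rw [← real_inner_self_eq_norm_sq, ← ContinuousLinearMap.adjoint_inner_left]
      simp only [ContinuousLinearMap.comp_apply] at hx
      rw [hx, inner_zero_left]
    have h0 : L x = 0 := by simpa using this
    exact hL (by rw [h0, map_zero])
  let e := (LinearEquiv.ofInjectiveEndo
    ((ContinuousLinearMap.adjoint L ∘L L : E →L[ℝ] E) : E →ₗ[ℝ] E) hinj).toContinuousLinearEquiv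
  refine ⟨ContinuousLinearEquiv.toUnit e, ?_⟩
  ext x
  rfl

theorem leftPseudoInverse_apply_self [FiniteDimensional ℝ E] {L : E →L[ℝ] F} (hL : Function.Injective L) (x : E) :
    leftPseudoInverse L (L x) = x := by
  have := Ring.inverse_mul_cancel _ (isUnit_adjoint_comp_self hL)
  simpa [leftPseudoInverse] using congrArg (fun T : E →L[ℝ] E => T x) this

/-- The pseudo-inverse sees `z` only through `L* z`, so components normal to the range of `L` are
lost. -/
theorem leftPseudoInverse_eq_of_adjoint_eq (L : E →L[ℝ] F) {z z' : F}
    (h : ∀ w, inner ℝ (L w) z = inner ℝ (L w) z') :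
    leftPseudoInverse L z = leftPseudoInverse L z' := by
  have : ContinuousLinearMap.adjoint L z = ContinuousLinearMap.adjoint L z' := by
    refine ext_inner_left ℝ fun w => ?_
    rw [ContinuousLinearMap.adjoint_inner_right, ContinuousLinearMap.adjoint_inner_right, h]
  simp only [leftPseudoInverse, ContinuousLinearMap.comp_apply]
  exact congrArg _ this

theorem continuousAt_leftPseudoInverse [FiniteDimensional ℝ E] {L : E →L[ℝ] F} (hL : Function.Injective L) :
    ContinuousAt (leftPseudoInverse : (E →L[ℝ] F) → F →L[ℝ] E) L := by
  unfold leftPseudoInverse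
  obtain ⟨u, hu⟩ := isUnit_adjoint_comp_self hL
  have hadj : Continuous fun L : E →L[ℝ] F => ContinuousLinearMap.adjoint L :=
    ContinuousLinearMap.adjoint.continuous
  refine ContinuousAt.clm_comp ?_ hadj.continuousAt
  refine ContinuousAt.comp (f := fun L : E →L[ℝ] F => ContinuousLinearMap.adjoint L ∘L L)
    (g := Ring.inverse) ?_ (hadj.clm_comp continuous_id).continuousAt
  have := NormedRing.inverse_continuousAt u
  rwa [hu] at this

end PseudoInverse

/-! ### Singular values -/

theorem norm_toEuclideanLin_le_sigmaMax {m n : Type*} [Fintype m] [Fintype n] [DecidableEq n]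
    (A : Matrix m n ℝ) (y : EuclideanSpace ℝ n) (hy : ‖y‖ = 1) :
    ‖Matrix.toEuclideanLin A y‖ ≤ sigmaMax A := by
  refine le_csSup ?_ ⟨y, by simpa using hy, rfl⟩
  refine ((isCompact_sphere _ _).image ?_).bddAbove
  exact (LinearMap.continuous_of_finiteDimensional (Matrix.toEuclideanLin A)).norm

theorem sigmaMin_mul_norm_le {m n : Type*} [Fintype m] [Fintype n] [DecidableEq n]
    (A : Matrix m n ℝ) (y : EuclideanSpace ℝ n) :
    sigmaMin A * ‖y‖ ≤ ‖Matrix.toEuclideanLin A y‖ := by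
  rcases eq_or_ne y 0 with rfl | hy
  · simp
  have hy' : 0 < ‖y‖ := norm_pos_iff.2 hy
  have h : sigmaMin A ≤ ‖Matrix.toEuclideanLin A (‖y‖⁻¹ • y)‖ := by
    refine csInf_le ⟨0, ?_⟩ ⟨‖y‖⁻¹ • y, ?_, rfl⟩
    · rintro _ ⟨z, -, rfl⟩
      positivity
    · simp [norm_smul, hy'.ne']
  rw [map_smul, norm_smul, norm_inv, norm_norm] at h
  calc sigmaMin A * ‖y‖ ≤ (‖y‖⁻¹ * ‖Matrix.toEuclideanLin A y‖) * ‖y‖ := by gcongr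
    _ = _ := by field_simp

theorem sum_col_sq_le_sigmaMax_sq {m n : Type*} [Fintype m] [Fintype n] [DecidableEq n]
    (A : Matrix m n ℝ) (k : n) : ∑ i, A i k ^ 2 ≤ sigmaMax A ^ 2 := by
  have h := norm_toEuclideanLin_le_sigmaMax A (EuclideanSpace.single k 1) (by simp)
  have h2 : ‖Matrix.toEuclideanLin A (EuclideanSpace.single k 1)‖ ^ 2 = ∑ i, A i k ^ 2 := by
    rw [EuclideanSpace.norm_sq_eq]
    simp [Matrix.toLpLin_apply]
  rw [← h2]
  gcongr

theorem CondNumberLE.sigmaMax_le {m n : Type*} [Fintype m] [Fintype n] [DecidableEq n]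
    {A : Matrix m n ℝ} {κ : ℝ} (h : CondNumberLE A κ) : sigmaMax A ≤ κ * sigmaMin A :=
  (div_le_iff₀ h.1).1 h.2

/-! ### Quadratic polynomials in two variables -/

/-- The degrees of the monomials in `quadMonomials`. -/
def quadDegree : Fin 6 → ℕ := ![0, 1, 1, 2, 2, 2]

theorem quadMonomials_smul (a : ℝ) (u : E2) (k : Fin 6) :
    quadMonomials (a • u) k = a ^ quadDegree k * quadMonomials u k := by
  fin_cases k <;> simp [quadMonomials, quadDegree] <;> ring

theorem abs_quadMonomials_le (u : E2) (k : Fin 6) : |quadMonomials u k| ≤ 1 + ‖u‖ ^ 2 := by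
  have h : ‖u‖ ^ 2 = u 0 ^ 2 + u 1 ^ 2 := by
    simp [EuclideanSpace.norm_sq_eq, Fin.sum_univ_two]
  rw [h, abs_le]
  fin_cases k <;> simp [quadMonomials] <;> constructor <;>
    nlinarith [sq_nonneg (u 0 - 1), sq_nonneg (u 0 + 1), sq_nonneg (u 1 - 1),
      sq_nonneg (u 1 + 1), sq_nonneg (u 0 - u 1), sq_nonneg (u 0 + u 1)]

/-- Turns the intrinsic expansion of `f` into a competitor for the least squares problem. As `K`
need not be symmetric, both mixed values enter the cross term. -/
theorem exists_quadEval_eq (a : ℝ) (l : E2 →ₗ[ℝ] ℝ) (K : E2 →ₗ[ℝ] E2 →ₗ[ℝ] ℝ) :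
    ∃ t : Fin 6 → ℝ, t 0 = a ∧ ∀ u, quadEval t u = a + l u + K u u := by
  set e : Fin 2 → E2 := fun i => EuclideanSpace.single i 1
  refine ⟨![a, l (e 0), l (e 1), K (e 0) (e 0), K (e 0) (e 1) + K (e 1) (e 0), K (e 1) (e 1)],
    rfl, fun u => ?_⟩
  have hu : u = u 0 • e 0 + u 1 • e 1 := by
    ext i; fin_cases i <;> simp [e]
  have h1 : l u = u 0 * l (e 0) + u 1 * l (e 1) := by
    conv_lhs => rw [hu]
    simp
  have h2 : K u u = u 0 * (u 0 * K (e 0) (e 0) + u 1 * K (e 0) (e 1))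
      + u 1 * (u 0 * K (e 1) (e 0) + u 1 * K (e 1) (e 1)) := by
    conv_lhs => rw [hu]
    simp
  rw [h1, h2]
  simp [quadEval, quadMonomials, Fin.sum_univ_succ]
  ring

/-! ### Stability of weighted least squares -/

namespace FittingScheme

variable {Ω : Set E3} {M : SurfaceMesh Ω} (S : FittingScheme M)

theorem norm_coord_le_stencilRadius {v x : E3} (hx : x ∈ S.stencil v) :
    ‖S.coord v x‖ ≤ S.stencilRadius v := by
  have := Finset.le_sup (f := fun x => ‖S.coord v x‖₊) hx
  exact_mod_cast this

theorem mem_columns_of_ne_zero {k : Fin 6} (hk : k ≠ 0) : k ∈ S.kind.columns := by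
  cases S.kind <;> simp [FitKind.columns, hk]

/-- If the radius were `0`, its inverse would be `0` by convention, and the column of a linear
monomial would vanish. -/
theorem stencilRadius_pos {v : E3} (h : 0 < sigmaMin (S.scaledVandermonde v)) :
    0 < S.stencilRadius v := by
  refine lt_of_le_of_ne (NNReal.coe_nonneg _) fun h0 => ?_
  have := sigmaMin_mul_norm_le (S.scaledVandermonde v)
    (EuclideanSpace.single ⟨1, S.mem_columns_of_ne_zero (by decide)⟩ 1)
  have h2 : Matrix.toEuclideanLin (S.scaledVandermonde v)
      (EuclideanSpace.single ⟨1, S.mem_columns_of_ne_zero (by decide)⟩ 1) = 0 := by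
    ext x
    simp [Matrix.toLpLin_apply, scaledVandermonde, ← h0, quadMonomials]
  rw [h2] at this
  simp at this
  linarith

/-- Only the two linear columns are used, since the constant one is missing from interpolating fits.
The remaining factor `‖u‖²` is bounded by the squared radius. -/
theorem sum_weight_mul_sq_le {v : E3} (h : 0 < sigmaMin (S.scaledVandermonde v)) :
    ∑ x ∈ S.stencil v, (S.weight v x * ‖S.coord v x‖ ^ 2) ^ 2 ≤
      2 * (S.stencilRadius v ^ 2 * sigmaMax (S.scaledVandermonde v)) ^ 2 := by
  have hρ := S.stencilRadius_pos h
  set ρ := S.stencilRadius v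
  have h1 := sum_col_sq_le_sigmaMax_sq (S.scaledVandermonde v)
    ⟨1, S.mem_columns_of_ne_zero (by decide)⟩
  have h2 := sum_col_sq_le_sigmaMax_sq (S.scaledVandermonde v)
    ⟨2, S.mem_columns_of_ne_zero (by decide)⟩
  have h3 : ∑ x ∈ S.stencil v, (S.weight v x * ‖S.coord v x‖ ^ 2) ^ 2 ≤
      ρ ^ 4 * ∑ x : {x // x ∈ S.stencil v},
        ((S.scaledVandermonde v) x ⟨1, S.mem_columns_of_ne_zero (by decide)⟩ ^ 2
          + (S.scaledVandermonde v) x ⟨2, S.mem_columns_of_ne_zero (by decide)⟩ ^ 2) := by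
    rw [← Finset.sum_coe_sort, Finset.mul_sum]
    refine Finset.sum_le_sum fun x _ => ?_
    have hx := S.norm_coord_le_stencilRadius x.2
    have hn : ‖S.coord v x‖ ^ 2 = S.coord v x 0 ^ 2 + S.coord v x 1 ^ 2 := by
      simp [EuclideanSpace.norm_sq_eq, Fin.sum_univ_two]
    have e : ρ ^ 4 * ((S.scaledVandermonde v) x ⟨1, S.mem_columns_of_ne_zero (by decide)⟩ ^ 2
          + (S.scaledVandermonde v) x ⟨2, S.mem_columns_of_ne_zero (by decide)⟩ ^ 2)
        = S.weight v x ^ 2 * ‖S.coord v x‖ ^ 2 * ρ ^ 2 := by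
      rw [hn]
      simp [scaledVandermonde, quadMonomials]
      field_simp
      simp [show S.stencilRadius v = ρ from rfl]
      field_simp
    rw [e]
    calc (S.weight v x * ‖S.coord v x‖ ^ 2) ^ 2
        = S.weight v x ^ 2 * ‖S.coord v x‖ ^ 2 * ‖S.coord v x‖ ^ 2 := by ring
      _ ≤ _ := by gcongr
  rw [Finset.sum_add_distrib] at h3
  calc _ ≤ _ := h3
    _ ≤ ρ ^ 4 * (sigmaMax (S.scaledVandermonde v) ^ 2 + sigmaMax (S.scaledVandermonde v) ^ 2) := by
      gcongr
    _ = _ := by ring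

/-- Stability of the weighted least squares fitting: it reproduces, up to a multiple of `ε`, every
admissible quadratic polynomial that matches the data up to `ε ‖u‖²`. -/
theorem IsWLSFit.abs_sub_le {S : FittingScheme M} {f : E3 → ℝ} {v : E3} {c t : Fin 6 → ℝ}
    {κ ε : ℝ} (hc : S.IsWLSFit f v c) (hκ : CondNumberLE (S.scaledVandermonde v) κ)
    (ht : t 0 = f v) (hε : 0 ≤ ε)
    (hr : ∀ x ∈ S.stencil v, |quadEval t (S.coord v x) - f x| ≤ ε * ‖S.coord v x‖ ^ 2) (u : E2) :
    |quadEval c u - quadEval t u| ≤ 18 * κ * ε * (S.stencilRadius v ^ 2 + ‖u‖ ^ 2) := by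
  have hρ := S.stencilRadius_pos hκ.1
  have hmax := S.sum_weight_mul_sq_le hκ.1
  have hmin := hκ.sigmaMax_le
  have hpos := hκ.1
  set ρ := S.stencilRadius v with hρdef
  set A := S.scaledVandermonde v with hA
  have hmax0 : 0 ≤ sigmaMax A :=
    (norm_nonneg _).trans (norm_toEuclideanLin_le_sigmaMax A
      (EuclideanSpace.single ⟨1, S.mem_columns_of_ne_zero (by decide)⟩ 1) (by simp))
  have hrt : S.residual f v t ≤ 2 * (ε * (ρ ^ 2 * sigmaMax A)) ^ 2 := by
    calc S.residual f v t ≤ ∑ x ∈ S.stencil v, ε ^ 2 * (S.weight v x * ‖S.coord v x‖ ^ 2) ^ 2 := by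
          refine Finset.sum_le_sum fun x hx => ?_
          rw [mul_pow, ← sq_abs (quadEval _ _ - _)]
          calc _ ≤ S.weight v x ^ 2 * (ε * ‖S.coord v x‖ ^ 2) ^ 2 := by
                gcongr
                exact hr x hx
            _ = _ := by ring
      _ ≤ _ := by
        rw [← Finset.mul_sum]
        nlinarith [sq_nonneg ε]
  have hrc : S.residual f v c ≤ S.residual f v t := hc.2 (show t ∈ S.admissible f v from fun _ => ht)
  -- Coefficients of the difference in the scaled monomials, so that the scaled Vandermonde matrix
  -- sends `d` to the weighted differences on the stencil.
  set d : EuclideanSpace ℝ {k // k ∈ S.kind.columns} :=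
    WithLp.toLp 2 fun k => ρ ^ quadDegree k * (c k - t k) with hd
  have hzero : ∀ k, k ∉ S.kind.columns → c k - t k = 0 := by
    intro k hk
    have hadm := hc.1
    unfold admissible at hadm
    have hk0 : k = 0 := by
      by_contra h
      exact hk (S.mem_columns_of_ne_zero h)
    subst hk0
    cases hkind : S.kind with
    | free => simp [hkind, FitKind.columns] at hk
    | interpolating => rw [ht, hadm hkind, sub_self]
  have hdiff : ∀ w : E2, ∑ k : {k // k ∈ S.kind.columns}, d k * quadMonomials (ρ⁻¹ • w) k
      = quadEval c w - quadEval t w := by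
    intro w
    have : ∀ k : {k // k ∈ S.kind.columns}, d k * quadMonomials (ρ⁻¹ • w) k
        = (c k - t k) * quadMonomials w k := by
      intro k
      rw [quadMonomials_smul, hd]
      simp only
      rw [inv_pow]
      field_simp
    rw [Finset.sum_congr rfl fun k _ => this k,
      Finset.sum_coe_sort S.kind.columns fun k => (c k - t k) * quadMonomials w k,
      Finset.sum_subset (Finset.subset_univ _)]
    · simp [quadEval, ← Finset.sum_sub_distrib, sub_mul]
    · intro k _ hk
      rw [hzero k hk, zero_mul]
  have hAd : ‖Matrix.toEuclideanLin A d‖ ^ 2 ≤ 8 * (ε * (ρ ^ 2 * sigmaMax A)) ^ 2 := by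
    have h1 : ‖Matrix.toEuclideanLin A d‖ ^ 2 = ∑ x ∈ S.stencil v,
        (S.weight v x * (quadEval c (S.coord v x) - quadEval t (S.coord v x))) ^ 2 := by
      rw [EuclideanSpace.norm_sq_eq, ← Finset.sum_coe_sort (S.stencil v) fun x =>
        (S.weight v x * (quadEval c (S.coord v x) - quadEval t (S.coord v x))) ^ 2]
      refine Finset.sum_congr rfl fun x _ => ?_
      rw [← hdiff, Real.norm_eq_abs, sq_abs, Finset.mul_sum]
      congr 1
      simp only [Matrix.toLpLin_apply, Matrix.mulVec, dotProduct, hA, scaledVandermonde,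
        Matrix.of_apply]
      refine Finset.sum_congr rfl fun k _ => ?_
      rw [hρdef]
      ring
    -- The difference of the two polynomials is the difference of their residuals, and `(a - b)² ≤
    -- 2a² + 2b²`.
    have h2 : ‖Matrix.toEuclideanLin A d‖ ^ 2 ≤ 2 * S.residual f v c + 2 * S.residual f v t := by
      rw [h1, residual, residual, Finset.mul_sum, Finset.mul_sum, ← Finset.sum_add_distrib]
      refine Finset.sum_le_sum fun x _ => ?_
      nlinarith [sq_nonneg (S.weight v x * (quadEval c (S.coord v x) - f x)
        + S.weight v x * (quadEval t (S.coord v x) - f x))]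
    linarith
  have hdn : ‖d‖ ≤ 3 * κ * ε * ρ ^ 2 := by
    -- The factor `3` rounds up `√8`; six monomials then give the final `18`.
    have h1 : ‖Matrix.toEuclideanLin A d‖ ≤ 3 * (ε * (ρ ^ 2 * sigmaMax A)) := by
      refine abs_le_of_sq_le_sq' ?_ (by positivity) |>.2
      nlinarith [sq_nonneg (ε * (ρ ^ 2 * sigmaMax A))]
    have h2 := sigmaMin_mul_norm_le A d
    have h3 : sigmaMin A * ‖d‖ ≤ sigmaMin A * (3 * κ * ε * ρ ^ 2) := by
      calc _ ≤ 3 * (ε * (ρ ^ 2 * sigmaMax A)) := h2.trans h1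
        _ ≤ 3 * (ε * (ρ ^ 2 * (κ * sigmaMin A))) := by gcongr
        _ = _ := by ring
    exact le_of_mul_le_mul_left h3 hpos
  rw [← hdiff]
  calc |∑ k : {k // k ∈ S.kind.columns}, d k * quadMonomials (ρ⁻¹ • u) k|
      ≤ ∑ k : {k // k ∈ S.kind.columns}, |d k * quadMonomials (ρ⁻¹ • u) k| :=
        Finset.abs_sum_le_sum_abs _ _
    _ ≤ ∑ _k : {k // k ∈ S.kind.columns}, 3 * κ * ε * ρ ^ 2 * (1 + ‖ρ⁻¹ • u‖ ^ 2) := by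
        refine Finset.sum_le_sum fun k _ => ?_
        rw [abs_mul]
        have := (PiLp.norm_apply_le d k).trans hdn
        rw [Real.norm_eq_abs] at this
        exact mul_le_mul this (abs_quadMonomials_le _ _) (abs_nonneg _)
          ((abs_nonneg _).trans this)
    _ = S.kind.columns.card * (3 * κ * ε * (ρ ^ 2 + ‖u‖ ^ 2)) := by
        simp [norm_smul, abs_of_pos hρ]
        left
        field_simp
    _ ≤ 6 * (3 * κ * ε * (ρ ^ 2 + ‖u‖ ^ 2)) := by
        have h6 : (S.kind.columns.card : ℝ) ≤ 6 := by
          exact_mod_cast (Finset.card_le_univ S.kind.columns)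
        have hn : 0 ≤ 3 * κ * ε * ρ ^ 2 := (norm_nonneg _).trans hdn
        have hn' : 0 ≤ 3 * κ * ε := by
          by_contra! h
          nlinarith [pow_pos hρ 2]
        gcongr
    _ = _ := by ring

end FittingScheme

/-! ### Expansions in the coordinate `A (x - v)` -/

section LocalExpansion

variable {E F : Type*} [NormedAddCommGroup E] [NormedSpace ℝ E] [NormedAddCommGroup F]
  [NormedSpace ℝ F]

/-- The quadratic part of the expansion of a function in the coordinate `A (x - v)`, where `A` is a
left inverse of the differential of the parametrization, `B` the second differential of the
parametrization, and `l`, `H` the first two differentials of the function in the parameter. -/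
noncomputable def coordinateHessian (A : F →L[ℝ] E) (B : E →L[ℝ] E →L[ℝ] F) (l : E →L[ℝ] ℝ)
    (H : E →L[ℝ] E →L[ℝ] ℝ) : E →L[ℝ] E →L[ℝ] ℝ :=
  (2⁻¹ : ℝ) • (H - (ContinuousLinearMap.compL ℝ E F ℝ (l ∘L A)) ∘L B)

theorem coordinateHessian_apply (A : F →L[ℝ] E) (B : E →L[ℝ] E →L[ℝ] F) (l : E →L[ℝ] ℝ)
    (H : E →L[ℝ] E →L[ℝ] ℝ) (y y' : E) :
    coordinateHessian A B l H y y' = 2⁻¹ * (H y y' - l (A (B y y'))) := by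
  simp [coordinateHessian]

theorem ContinuousOn.coordinateHessian {X : Type*} [TopologicalSpace X] {W : Set X}
    {A : X → F →L[ℝ] E} {B : X → E →L[ℝ] E →L[ℝ] F} {l : X → E →L[ℝ] ℝ}
    {H : X → E →L[ℝ] E →L[ℝ] ℝ} (hA : ContinuousOn A W) (hB : ContinuousOn B W)
    (hl : ContinuousOn l W) (hH : ContinuousOn H W) :
    ContinuousOn (fun s => coordinateHessian (A s) (B s) (l s) (H s)) W :=
  (hH.sub (((ContinuousLinearMap.compL ℝ E F ℝ).continuous.comp_continuousOn
    (hl.clm_comp hA)).clm_comp hB)).const_smul (2⁻¹ : ℝ)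

theorem abs_coordinateHessian_le {A : F →L[ℝ] E} {B : E →L[ℝ] E →L[ℝ] F}
    {l : E →L[ℝ] ℝ} {H : E →L[ℝ] E →L[ℝ] ℝ} {N : ℝ} (hN : 1 ≤ N) (hA : ‖A‖ ≤ N) (hB : ‖B‖ ≤ N)
    (hl : ‖l‖ ≤ N) (hH : ‖H‖ ≤ N) (x x' : E) :
    |coordinateHessian A B l H x x'| ≤ N ^ 3 * (‖x‖ * ‖x'‖) := by
  have hN0 : 0 ≤ N := by linarith
  rw [coordinateHessian_apply, abs_mul]
  have h1 : |H x x'| ≤ N * (‖x‖ * ‖x'‖) := by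
    calc |H x x'| ≤ ‖H‖ * ‖x‖ * ‖x'‖ := H.le_opNorm₂ x x'
      _ ≤ N * ‖x‖ * ‖x'‖ := by gcongr
      _ = _ := by ring
  have h2 : |l (A (B x x'))| ≤ N * (N * (N * (‖x‖ * ‖x'‖))) := by
    refine (l.le_of_opNorm_le hl _).trans ?_
    gcongr
    refine (A.le_of_opNorm_le hA _).trans ?_
    gcongr
    calc ‖B x x'‖ ≤ ‖B‖ * ‖x‖ * ‖x'‖ := B.le_opNorm₂ x x'
      _ ≤ N * ‖x‖ * ‖x'‖ := by gcongr
      _ = _ := by ring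
  have h3 := abs_sub (H x x') (l (A (B x x')))
  have h4 : N ≤ N ^ 3 := le_self_pow₀ hN (by norm_num)
  have h5 : 0 ≤ ‖x‖ * ‖x'‖ := by positivity
  rw [abs_of_pos (by norm_num : (0 : ℝ) < 2⁻¹)]
  nlinarith [mul_le_mul_of_nonneg_right h4 h5]

/-- Change of coordinates in a second-order expansion. -/
theorem expansion_in_coordinate {A : F →L[ℝ] E} {L : E →L[ℝ] F} {B : E →L[ℝ] E →L[ℝ] F}
    {l : E →L[ℝ] ℝ} {H : E →L[ℝ] E →L[ℝ] ℝ} {N ε a : ℝ} {d : E} {z : F}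
    (hAL : ∀ x, A (L x) = x) (hN : 1 ≤ N) (hA : ‖A‖ ≤ N) (hL : ‖L‖ ≤ N) (hB : ‖B‖ ≤ N)
    (hl : ‖l‖ ≤ N) (hH : ‖H‖ ≤ N) (hε : 4 * N ^ 2 * ε ≤ 1) (hd : ‖d‖ ≤ ε)
    (hz : ‖z - L d - (2⁻¹ : ℝ) • B d d‖ ≤ ε * ‖d‖ ^ 2)
    (ha : ‖a - l d - (2⁻¹ : ℝ) • H d d‖ ≤ ε * ‖d‖ ^ 2) :
    ‖z‖ ≤ 6 * N * ‖A z‖ ∧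
      |a - l (A z) - coordinateHessian A B l H (A z) (A z)| ≤ 28 * N ^ 5 * ε * ‖A z‖ ^ 2 := by
  have hε0 : 0 ≤ ε := (norm_nonneg d).trans hd
  have hN0 : 0 ≤ N := by linarith
  have hN2 : N ≤ N ^ 2 := by nlinarith
  have hε1 : ε ≤ 1 := by nlinarith
  set e := z - L d - (2⁻¹ : ℝ) • B d d with he
  have hzeq : z = L d + (2⁻¹ : ℝ) • B d d + e := by rw [he]; abel
  have hBd : ∀ x, ‖B x x‖ ≤ N * ‖x‖ ^ 2 := fun x => by
    calc _ ≤ ‖B‖ * ‖x‖ * ‖x‖ := B.le_opNorm₂ x x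
      _ ≤ N * ‖x‖ * ‖x‖ := by gcongr
      _ = _ := by ring
  have hAx : ∀ x, ‖A x‖ ≤ N * ‖x‖ := fun x => A.le_of_opNorm_le hA x
  have hlx : ∀ x, ‖l x‖ ≤ N * ‖x‖ := fun x => l.le_of_opNorm_le hl x
  set y := A z with hy
  have hyeq : y = d + (2⁻¹ : ℝ) • A (B d d) + A e := by
    rw [hy, hzeq, map_add, map_add, hAL, map_smul]
  have hABd : ‖(2⁻¹ : ℝ) • A (B d d)‖ ≤ 2⁻¹ * (N * (N * ‖d‖ ^ 2)) := by
    rw [norm_smul]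
    norm_num
    exact (hAx _).trans (by gcongr; exact hBd d)
  have hAe : ‖A e‖ ≤ N * (ε * ‖d‖ ^ 2) := (hAx e).trans (by gcongr)
  -- `y` and the parameter increment `d` agree to first order, so for small `d` they are comparable
  -- and either may measure the error.
  have hyd : ‖y - d‖ ≤ 2 * N ^ 2 * ‖d‖ ^ 2 := by
    have : y - d = (2⁻¹ : ℝ) • A (B d d) + A e := by rw [hyeq]; abel
    rw [this]
    refine (norm_add_le _ _).trans ((add_le_add hABd hAe).trans ?_)
    have h1 : N * ε ≤ N ^ 2 := by nlinarith
    nlinarith [sq_nonneg ‖d‖, mul_le_mul_of_nonneg_right h1 (sq_nonneg ‖d‖),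
      mul_nonneg (sq_nonneg N) (sq_nonneg ‖d‖)]
  have hyd' : ‖y - d‖ ≤ 2⁻¹ * ‖d‖ := by
    refine hyd.trans ?_
    have : 4 * N ^ 2 * ‖d‖ ≤ 1 := le_trans (by gcongr) hε
    nlinarith [norm_nonneg d]
  have hdy : ‖d‖ ≤ 2 * ‖y‖ := by
    have := norm_sub_norm_le d y
    rw [norm_sub_rev] at this
    linarith
  have hyle : ‖y‖ ≤ 3 / 2 * ‖d‖ := by
    have := norm_sub_norm_le y d
    linarith
  have hdd : ‖d‖ ^ 2 ≤ ‖d‖ := by nlinarith [norm_nonneg d]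
  constructor
  · have h1 : ‖z‖ ≤ 3 * N * ‖d‖ := by
      rw [hzeq]
      refine (norm_add₃_le).trans ?_
      have h2 : ‖L d‖ ≤ N * ‖d‖ := L.le_of_opNorm_le hL d
      have h3 : ‖(2⁻¹ : ℝ) • B d d‖ ≤ 2⁻¹ * (N * ‖d‖ ^ 2) := by
        rw [norm_smul]
        norm_num
        exact hBd d
      nlinarith [norm_nonneg d, sq_nonneg ‖d‖, mul_le_mul_of_nonneg_left hdd hN0,
        mul_le_mul_of_nonneg_right hε1 (sq_nonneg ‖d‖)]
    nlinarith
  · set K := coordinateHessian A B l H with hK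
    have hKb : ∀ x x' : E, |K x x'| ≤ N ^ 3 * (‖x‖ * ‖x'‖) :=
      abs_coordinateHessian_le hN hA hB hl hH
    -- The correction in `K` cancels the second-order part of `l y`. What remains is the Taylor
    -- errors and the cost of evaluating `K` at `y` instead of `d`.
    have hdecomp : a - l y - K y y
        = (a - l d - (2⁻¹ : ℝ) • H d d) - l (A e) - (K (y - d) y + K d (y - d)) := by
      have h1 : K (y - d) y + K d (y - d) = K y y - K d d := by simp
      have h2 : l y = l d + 2⁻¹ * l (A (B d d)) + l (A e) := by rw [hyeq]; simp
      rw [h1, h2, hK, coordinateHessian_apply A B l H d d, smul_eq_mul]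
      ring
    have hlAe : |l (A e)| ≤ N * (N * (ε * ‖d‖ ^ 2)) := (hlx _).trans (by gcongr)
    have hK1 : |K (y - d) y| ≤ N ^ 3 * (2 * N ^ 2 * ‖d‖ ^ 2 * (3 / 2 * ε)) := by
      refine (hKb _ _).trans ?_
      gcongr
      exact hyle.trans (by gcongr)
    have hK2 : |K d (y - d)| ≤ N ^ 3 * (ε * (2 * N ^ 2 * ‖d‖ ^ 2)) := by
      refine (hKb _ _).trans ?_
      gcongr
    have h5 : N ^ 2 ≤ N ^ 5 := pow_le_pow_right₀ hN (by norm_num)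
    have h6 : (1 : ℝ) ≤ N ^ 5 := one_le_pow₀ hN
    have h7 : 0 ≤ ε * ‖d‖ ^ 2 := by positivity
    rw [Real.norm_eq_abs] at ha
    rw [hdecomp]
    have htri : ∀ p q u w : ℝ, |p - q - (u + w)| ≤ |p| + |q| + (|u| + |w|) := fun p q u w =>
      (abs_sub _ _).trans (add_le_add (abs_sub _ _) (abs_add_le _ _))
    calc _ ≤ |a - l d - (2⁻¹ : ℝ) • H d d| + |l (A e)| + (|K (y - d) y| + |K d (y - d)|) :=
          htri _ _ _ _
      _ ≤ ε * ‖d‖ ^ 2 + N * (N * (ε * ‖d‖ ^ 2)) + (N ^ 3 * (2 * N ^ 2 * ‖d‖ ^ 2 * (3 / 2 * ε))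
          + N ^ 3 * (ε * (2 * N ^ 2 * ‖d‖ ^ 2))) :=
        add_le_add (add_le_add ha hlAe) (add_le_add hK1 hK2)
      _ = (1 + N ^ 2 + 5 * N ^ 5) * (ε * ‖d‖ ^ 2) := by ring
      _ ≤ (7 * N ^ 5) * (ε * ‖d‖ ^ 2) := by gcongr; linarith
      _ ≤ (7 * N ^ 5) * (ε * (2 * ‖y‖) ^ 2) := by gcongr
      _ = _ := by ring

/-- The minimum over the compact unit sphere, extended by homogeneity. -/
theorem exists_pos_mul_norm_sq_le [FiniteDimensional ℝ E] (K : E →L[ℝ] E →L[ℝ] ℝ)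
    (hK : ∀ x, x ≠ 0 → 0 < K x x) : ∃ m > 0, ∀ x, m * ‖x‖ ^ 2 ≤ K x x := by
  rcases subsingleton_or_nontrivial E with hE | hE
  · exact ⟨1, one_pos, fun x => by simp [Subsingleton.elim x 0]⟩
  have hne : (Metric.sphere (0 : E) 1).Nonempty := NormedSpace.sphere_nonempty.2 zero_le_one
  obtain ⟨x₀, hx₀, hmin⟩ := (isCompact_sphere (0 : E) 1).exists_isMinOn hne
    (f := fun x => K x x) (by fun_prop)
  have hx₀0 : x₀ ≠ 0 := by
    rintro rfl
    simp at hx₀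
  refine ⟨K x₀ x₀, hK x₀ hx₀0, fun x => ?_⟩
  rcases eq_or_ne x 0 with rfl | hx
  · simp
  have hx' : 0 < ‖x‖ := norm_pos_iff.2 hx
  have h : K x₀ x₀ ≤ K (‖x‖⁻¹ • x) (‖x‖⁻¹ • x) := hmin (by simp [norm_smul, hx'.ne'])
  simp only [map_smul, smul_apply, smul_eq_mul] at h
  calc K x₀ x₀ * ‖x‖ ^ 2 ≤ (‖x‖⁻¹ * (‖x‖⁻¹ * K x x)) * ‖x‖ ^ 2 := by gcongr
    _ = K x x := by field_simp

end LocalExpansion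

/-! ### Uniform expansions near the critical point -/

/-- Near a point where the gradient of `f` vanishes and its Hessian is positive definite, `f` has
uniform second-order expansions with uniformly convex quadratic parts in the coordinates
`leftPseudoInverse (fderiv ℝ φ s) (x - v)`, at all points `v = φ s`. -/
theorem G2Chart.exists_uniform_expansion {Ω : Set E3} (φ : G2Chart Ω) {s₀ : E2}
    (hs₀ : s₀ ∈ φ.source) {f : E3 → ℝ} (hf : ContDiffAt ℝ 2 (f ∘ φ.toFun) s₀)
    (hgrad : fderiv ℝ (f ∘ φ.toFun) s₀ = 0) (hpos : ∀ ξ : E2, ξ ≠ 0 → 0 < φ.hessian f s₀ ξ) :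
    ∃ r > 0, ∃ C > 0, ∃ m > 0, ∀ ε > 0, ∃ η > 0, ∀ v ∈ Ω, dist v (φ.toFun s₀) < r →
      ∃ s ∈ φ.source, φ.toFun s = v ∧ ‖leftPseudoInverse (fderiv ℝ φ.toFun s)‖ ≤ C ∧
        ∃ (l : E2 →L[ℝ] ℝ) (K : E2 →L[ℝ] E2 →L[ℝ] ℝ), (∀ y, m * ‖y‖ ^ 2 ≤ K y y) ∧
          ∀ x ∈ Ω, dist x v < η → ∀ y, y = leftPseudoInverse (fderiv ℝ φ.toFun s) (x - v) →
            ‖x - v‖ ≤ C * ‖y‖ ∧ |f x - (f v + l y + K y y)| ≤ ε * ‖y‖ ^ 2 := by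
  set g : E2 → ℝ := f ∘ φ.toFun with hg
  obtain ⟨W, hWsub, hW, hs₀W⟩ : ∃ W ⊆ {s | ContDiffAt ℝ 2 g s} ∩ φ.source, IsOpen W ∧ s₀ ∈ W :=
    mem_nhds_iff.1 (Filter.inter_mem (hf.eventually (by simp)) (φ.isOpen_source.mem_nhds hs₀))
  have hgW : ContDiffOn ℝ 2 g W := fun s hs =>
    ContDiffAt.contDiffWithinAt (show ContDiffAt ℝ 2 g s from (hWsub hs).1)
  have hφW : ContDiffOn ℝ 2 φ.toFun W := φ.contDiffOn.mono fun s hs => (hWsub hs).2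
  have hinj : ∀ s ∈ W, Function.Injective (fderiv ℝ φ.toFun s) := fun s hs =>
    φ.injective_fderiv s (hWsub hs).2
  have cg1 : ContinuousOn (fderiv ℝ g) W := hgW.continuousOn_fderiv_of_isOpen hW (by norm_num)
  have cφ1 : ContinuousOn (fderiv ℝ φ.toFun) W :=
    hφW.continuousOn_fderiv_of_isOpen hW (by norm_num)
  have cg2 := continuousOn_fderiv_fderiv hW hgW
  have cφ2 := continuousOn_fderiv_fderiv hW hφW
  set A : E2 → E3 →L[ℝ] E2 := fun s => leftPseudoInverse (fderiv ℝ φ.toFun s) with hA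
  have cA : ContinuousOn A W := fun s hs =>
    ContinuousAt.comp_continuousWithinAt (continuousAt_leftPseudoInverse (hinj s hs)) (cφ1 s hs)
  set K : E2 → E2 →L[ℝ] E2 →L[ℝ] ℝ := fun s => coordinateHessian (A s)
    (fderiv ℝ (fderiv ℝ φ.toFun) s) (fderiv ℝ g s) (fderiv ℝ (fderiv ℝ g) s) with hK
  have cK : ContinuousOn K W := cA.coordinateHessian cφ2 cg1 cg2
  -- The vanishing gradient enters only here: it removes the curvature correction and leaves half
  -- the Hessian.
  obtain ⟨m, hm, hmK⟩ : ∃ m > 0, ∀ y, m * ‖y‖ ^ 2 ≤ K s₀ y y := by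
    refine exists_pos_mul_norm_sq_le (K s₀) fun y hy => ?_
    simp only [hK, coordinateHessian_apply, hgrad]
    have := hpos y hy
    rw [G2Chart.hessian] at this
    simpa using this
  have hnear : ∀ᶠ s in 𝓝 s₀, s ∈ W ∧ dist (K s) (K s₀) < m / 2 :=
    (hW.eventually_mem hs₀W).and
      (Metric.tendsto_nhds.1 (cK.continuousAt (hW.mem_nhds hs₀W)) _ (half_pos hm))
  obtain ⟨R, hR, hRsub⟩ := Metric.nhds_basis_closedBall.mem_iff.1 hnear
  set D := Metric.closedBall s₀ R with hD
  have hDW : D ⊆ W := fun s hs => (hRsub hs).1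
  have hDK : ∀ s ∈ D, ∀ y, m / 2 * ‖y‖ ^ 2 ≤ K s y y := by
    intro s hs y
    have h1 : ‖K s - K s₀‖ ≤ m / 2 := (dist_eq_norm (K s) (K s₀)).symm.trans_le (hRsub hs).2.le
    have h2 : |K s y y - K s₀ y y| ≤ m / 2 * ‖y‖ ^ 2 := by
      calc |K s y y - K s₀ y y| = ‖(K s - K s₀) y y‖ := by simp
        _ ≤ ‖K s - K s₀‖ * ‖y‖ * ‖y‖ := (K s - K s₀).le_opNorm₂ y y
        _ ≤ m / 2 * ‖y‖ * ‖y‖ := by gcongr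
        _ = _ := by ring
    have h3 := hmK y
    have h4 := (abs_le.1 h2).1
    linarith
  have hDcpt : IsCompact D := isCompact_closedBall s₀ R
  have hDconv : Convex ℝ D := convex_closedBall s₀ R
  obtain ⟨N, hN, hNb⟩ : ∃ N : ℝ, 1 ≤ N ∧ ∀ s ∈ D, ‖A s‖ ≤ N ∧ ‖fderiv ℝ φ.toFun s‖ ≤ N ∧
      ‖fderiv ℝ (fderiv ℝ φ.toFun) s‖ ≤ N ∧ ‖fderiv ℝ g s‖ ≤ N ∧
      ‖fderiv ℝ (fderiv ℝ g) s‖ ≤ N := by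
    have hc : ContinuousOn (fun s => ‖A s‖ + ‖fderiv ℝ φ.toFun s‖ +
        ‖fderiv ℝ (fderiv ℝ φ.toFun) s‖ + ‖fderiv ℝ g s‖ + ‖fderiv ℝ (fderiv ℝ g) s‖) D :=
      ((((cA.norm.add cφ1.norm).add cφ2.norm).add cg1.norm).add cg2.norm).mono hDW
    obtain ⟨N, hN⟩ := (hDcpt.image_of_continuousOn hc).bddAbove
    refine ⟨max 1 N, le_max_left _ _, fun s hs => ?_⟩
    have h := (hN ⟨s, hs, rfl⟩).trans (le_max_right 1 N)
    simp only at h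
    have h1 := (A s).opNorm_nonneg
    have h2 := (fderiv ℝ φ.toFun s).opNorm_nonneg
    have h3 := (fderiv ℝ (fderiv ℝ φ.toFun) s).opNorm_nonneg
    have h4 := (fderiv ℝ g s).opNorm_nonneg
    have h5 := (fderiv ℝ (fderiv ℝ g) s).opNorm_nonneg
    refine ⟨?_, ?_, ?_, ?_, ?_⟩ <;> linarith
  have hmapD : ∀ s ∈ D, s ∈ φ.source := fun s hs => (hWsub (hDW hs)).2
  have hp : φ.toFun s₀ ∈ Ω ∩ φ.nbhd := φ.image_source ▸ Set.mem_image_of_mem _ hs₀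
  obtain ⟨r, hr, hrD⟩ : ∃ r > 0, ∀ x ∈ Ω, dist x (φ.toFun s₀) < r →
      φ.invFun x ∈ D ∧ φ.toFun (φ.invFun x) = x := by
    obtain ⟨r₁, hr₁, h₁⟩ := Metric.isOpen_iff.1 φ.isOpen_nbhd _ hp.2
    obtain ⟨r₂, hr₂, h₂⟩ := Metric.continuousOn_iff.1 φ.continuousOn_invFun _ hp R hR
    refine ⟨min r₁ r₂, lt_min hr₁ hr₂, fun x hx hxr => ?_⟩
    have hxn : x ∈ Ω ∩ φ.nbhd := ⟨hx, h₁ (hxr.trans_le (min_le_left _ _))⟩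
    constructor
    · have := h₂ x hxn (hxr.trans_le (min_le_right _ _))
      rw [φ.leftInvOn hs₀] at this
      exact this.le
    · rw [← φ.image_source] at hxn
      obtain ⟨t, ht, rfl⟩ := hxn
      rw [φ.leftInvOn ht]
  -- Halving `r` keeps every `x` within `r / 2` of `v` in the region covered by `D`.
  refine ⟨r / 2, half_pos hr, 6 * N, by linarith, m / 2, half_pos hm, fun ε hε => ?_⟩
  have hN0 : 0 < N := by linarith
  set ε' := min (ε / (28 * N ^ 5)) (1 / (4 * N ^ 2)) with hε'
  have hε'0 : 0 < ε' := lt_min (by positivity) (by positivity)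
  obtain ⟨δ₁, hδ₁, hT₁⟩ := exists_norm_sub_taylor_two_le hW hφW hDW hDcpt hDconv hε'0
  obtain ⟨δ₂, hδ₂, hT₂⟩ := exists_norm_sub_taylor_two_le hW hgW hDW hDcpt hDconv hε'0
  -- Compactness makes closeness in space imply closeness of parameters, uniformly in the base
  -- point.
  have hinvu : UniformContinuousOn φ.invFun (φ.toFun '' D) := by
    refine (hDcpt.image_of_continuousOn ((φ.contDiffOn.continuousOn).mono
      hmapD)).uniformContinuousOn_of_continuous (φ.continuousOn_invFun.mono ?_)
    rw [← φ.image_source]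
    exact Set.image_mono hmapD
  obtain ⟨η, hη, hηinv⟩ := Metric.uniformContinuousOn_iff.1 hinvu (min (min δ₁ δ₂) ε')
    (lt_min (lt_min hδ₁ hδ₂) hε'0)
  refine ⟨min η (r / 2), lt_min hη (half_pos hr), fun v hv hvr => ?_⟩
  obtain ⟨hsD, hsv⟩ := hrD v hv (by linarith)
  set s := φ.invFun v with hs
  obtain ⟨hbA, hbφ1, hbφ2, hbg1, hbg2⟩ := hNb s hsD
  refine ⟨s, hmapD s hsD, hsv, hbA.trans (by linarith), fderiv ℝ g s, K s, hDK s hsD,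
    fun x hx hxv => ?_⟩
  obtain ⟨htD, htx⟩ := hrD x hx (by
    have := dist_triangle x v (φ.toFun s₀)
    have := hxv.trans_le (min_le_right η (r / 2))
    linarith)
  set t := φ.invFun x with ht
  have hts : dist t s < min (min δ₁ δ₂) ε' :=
    hηinv x ⟨t, htD, htx⟩ v ⟨s, hsD, hsv⟩ (hxv.trans_le (min_le_left _ _))
  rw [dist_eq_norm] at hts
  have e₁ := hT₁ s hsD t htD (hts.trans_le ((min_le_left _ _).trans (min_le_left _ _)))
  have e₂ := hT₂ s hsD t htD (hts.trans_le ((min_le_left _ _).trans (min_le_right _ _)))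
  rw [htx, hsv] at e₁
  rw [show g t = f x by simp [hg, htx], show g s = f v by simp [hg, hsv]] at e₂
  have hε4 : 4 * N ^ 2 * ε' ≤ 1 := by
    calc 4 * N ^ 2 * ε' ≤ 4 * N ^ 2 * (1 / (4 * N ^ 2)) := by gcongr; exact min_le_right _ _
      _ = 1 := by field_simp
  have hε28 : 28 * N ^ 5 * ε' ≤ ε := by
    calc 28 * N ^ 5 * ε' ≤ 28 * N ^ 5 * (ε / (28 * N ^ 5)) := by gcongr; exact min_le_left _ _
      _ = ε := by field_simp
  obtain ⟨h1, h2⟩ := expansion_in_coordinate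
    (leftPseudoInverse_apply_self (hinj s (hDW hsD))) hN hbA hbφ1 hbφ2 hbg1 hbg2 hε4
    (hts.trans_le (min_le_right _ _)).le e₁ e₂
  rintro y rfl
  refine ⟨h1, ?_⟩
  rw [show ∀ a b : ℝ, f x - (f v + a + b) = f x - f v - a - b by intros; ring]
  exact h2.trans (by gcongr)

/-! ### Tangent frames -/

section Frames

/-- The point with coordinates `u` in the frame `e`. -/
noncomputable def frameSum (e : Fin 2 → E3) : E2 →ₗ[ℝ] E3 where
  toFun u := u 0 • e 0 + u 1 • e 1
  map_add' u u' := by simp [add_smul]; abel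
  map_smul' a u := by simp [mul_smul]

theorem frameSum_apply (e : Fin 2 → E3) (u : E2) : frameSum e u = u 0 • e 0 + u 1 • e 1 := rfl

theorem norm_frameSum {e : Fin 2 → E3} (he : Orthonormal ℝ e) (u : E2) : ‖frameSum e u‖ = ‖u‖ := by
  have h00 : inner ℝ (e 0) (e 0) = 1 := by simp [he.1 0]
  have h11 : inner ℝ (e 1) (e 1) = 1 := by simp [he.1 1]
  have h01 : inner ℝ (e 0) (e 1) = 0 := he.2 (by decide)
  have h10 : inner ℝ (e 1) (e 0) = 0 := he.2 (by decide)
  have h : ‖frameSum e u‖ ^ 2 = ‖u‖ ^ 2 := by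
    rw [← real_inner_self_eq_norm_sq, EuclideanSpace.norm_sq_eq, frameSum_apply]
    simp only [inner_add_left, inner_add_right, real_inner_smul_left, real_inner_smul_right, h00,
      h11, h01, h10, Fin.sum_univ_two, Real.norm_eq_abs, sq_abs]
    ring
  exact (sq_eq_sq₀ (norm_nonneg _) (norm_nonneg _)).1 h

theorem norm_localCoord_le {e : Fin 2 → E3} (he : Orthonormal ℝ e) (v x : E3) :
    ‖localCoord e v x‖ ≤ ‖x - v‖ := by
  have h : ‖localCoord e v x‖ ^ 2 ≤ ‖x - v‖ ^ 2 := by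
    have := he.sum_inner_products_le (x - v) (s := Finset.univ)
    simpa [EuclideanSpace.norm_sq_eq, localCoord, Fin.sum_univ_two] using this
  exact (sq_le_sq₀ (norm_nonneg _) (norm_nonneg _)).1 h

/-- By dimension the frame spans the range of `L`, so projecting `x - v` onto it discards only a
normal component. Hence `A (x - v)` is a linear function of the local coordinates. -/
theorem leftPseudoInverse_frameSum_localCoord {L : E2 →L[ℝ] E3} (hL : Function.Injective L)
    {e : Fin 2 → E3} (he : Orthonormal ℝ e)
    (heL : ∀ i, e i ∈ LinearMap.range (L : E2 →ₗ[ℝ] E3)) (v x : E3) :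
    leftPseudoInverse L (frameSum e (localCoord e v x)) = leftPseudoInverse L (x - v) := by
  have hspan : Submodule.span ℝ (Set.range e) = LinearMap.range (L : E2 →ₗ[ℝ] E3) := by
    refine Submodule.eq_of_le_of_finrank_eq ?_ ?_
    · rw [Submodule.span_le]
      rintro _ ⟨i, rfl⟩
      exact heL i
    · rw [finrank_span_eq_card he.linearIndependent, LinearMap.finrank_range_of_inj hL]
      simp
  refine leftPseudoInverse_eq_of_adjoint_eq L fun w => ?_
  have hw : L w ∈ Submodule.span ℝ (Set.range e) := hspan ▸ LinearMap.mem_range_self _ w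
  obtain ⟨a, ha⟩ := (Submodule.mem_span_range_iff_exists_fun ℝ).1 hw
  have h00 : inner ℝ (e 0) (e 0) = 1 := by simp [he.1 0]
  have h11 : inner ℝ (e 1) (e 1) = 1 := by simp [he.1 1]
  have h01 : inner ℝ (e 0) (e 1) = 0 := he.2 (by decide)
  have h10 : inner ℝ (e 1) (e 0) = 0 := he.2 (by decide)
  rw [← ha, frameSum_apply, Fin.sum_univ_two]
  simp only [inner_add_left, inner_add_right, real_inner_smul_left, real_inner_smul_right, h00,
    h11, h01, h10, localCoord]
  simp
  ring

end Frames

/-! ### The convexity gap -/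

section ConvexityGap

variable {ι E : Type*} [NormedAddCommGroup E] [InnerProductSpace ℝ E]

theorem sum_sub_mean_sq (K : E →L[ℝ] E →L[ℝ] ℝ) (s : Finset ι) (hs : s.Nonempty) (y : ι → E)
    {b : E} (hb : b = (s.card : ℝ)⁻¹ • ∑ i ∈ s, y i) :
    ∑ i ∈ s, K (y i - b) (y i - b) = ∑ i ∈ s, K (y i) (y i) - s.card * K b b := by
  have hc : (s.card : ℝ) ≠ 0 := by exact_mod_cast hs.card_pos.ne'
  have hsum : ∑ i ∈ s, y i = (s.card : ℝ) • b := by rw [hb, smul_inv_smul₀ hc]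
  have h1 : ∑ i ∈ s, K (y i) b = s.card * K b b := by
    have := congrArg (fun z => K z b) hsum
    simpa using this
  have h2 : ∑ i ∈ s, K b (y i) = s.card * K b b := by
    have := congrArg (fun z => K b z) hsum
    simpa using this
  simp only [map_sub, sub_apply, Finset.sum_sub_distrib, h1, h2,
    Finset.sum_const, nsmul_eq_mul]
  ring

/-- A uniformly convex quadratic form at the mean of points is smaller than the mean of its values,
with a gap bounded below in terms of the distance of two of the points. -/
theorem mean_sub_apply_mean_ge (K : E →L[ℝ] E →L[ℝ] ℝ) {m : ℝ} (hm : 0 ≤ m)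
    (hK : ∀ x, m * ‖x‖ ^ 2 ≤ K x x) (s : Finset ι) (y : ι → E)
    {b : E} (hb : b = (s.card : ℝ)⁻¹ • ∑ i ∈ s, y i) {i j : ι} (hi : i ∈ s) (hj : j ∈ s)
    (hij : i ≠ j) :
    m / (2 * s.card) * ‖y i - y j‖ ^ 2 ≤ (s.card : ℝ)⁻¹ * ∑ i ∈ s, K (y i) (y i) - K b b := by
  classical
  have hs : s.Nonempty := ⟨i, hi⟩
  have hc : (0 : ℝ) < s.card := by exact_mod_cast hs.card_pos
  -- Two terms of the variance already control the distance of `y i` and `y j`.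
  have h1 : ∑ k ∈ ({i, j} : Finset ι), m * ‖y k - b‖ ^ 2
      ≤ ∑ k ∈ s, K (y k - b) (y k - b) := by
    calc _ ≤ ∑ k ∈ s, m * ‖y k - b‖ ^ 2 := by
          refine Finset.sum_le_sum_of_subset_of_nonneg ?_ fun _ _ _ => by positivity
          intro k hk
          rcases Finset.mem_insert.1 hk with rfl | hk
          · exact hi
          · rwa [Finset.mem_singleton.1 hk]
      _ ≤ _ := Finset.sum_le_sum fun k _ => hK _
  rw [Finset.sum_pair hij, sum_sub_mean_sq K s hs y hb] at h1
  have h2 : ‖y i - y j‖ ^ 2 ≤ 2 * (‖y i - b‖ ^ 2 + ‖y j - b‖ ^ 2) := by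
    have h3 : ‖y i - y j‖ ≤ ‖y i - b‖ + ‖y j - b‖ := by
      have := norm_sub_le (y i - b) (y j - b)
      rwa [sub_sub_sub_cancel_right] at this
    nlinarith [norm_nonneg (y i - y j), sq_nonneg (‖y i - b‖ - ‖y j - b‖)]
  have h4 : m * ‖y i - y j‖ ^ 2 ≤ 2 * (∑ k ∈ s, K (y k) (y k) - s.card * K b b) := by
    nlinarith [mul_le_mul_of_nonneg_left h2 hm]
  calc m / (2 * s.card) * ‖y i - y j‖ ^ 2 = (2 * s.card : ℝ)⁻¹ * (m * ‖y i - y j‖ ^ 2) := by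
        field_simp
    _ ≤ (2 * s.card : ℝ)⁻¹ * (2 * (∑ k ∈ s, K (y k) (y k) - s.card * K b b)) := by gcongr
    _ = _ := by field_simp

end ConvexityGap

/-! ### Cells and their centers -/

theorem Finset.exists_diam_le_two_mul_dist {X : Type*} [PseudoMetricSpace X] {σ : Finset X} {v : X}
    (hv : v ∈ σ) : ∃ w ∈ σ, Metric.diam (σ : Set X) ≤ 2 * dist w v := by
  obtain ⟨w, hw, hmax⟩ := σ.exists_max_image (fun x => dist x v) ⟨v, hv⟩
  refine ⟨w, hw, Metric.diam_le_of_forall_dist_le (by positivity) fun x hx y hy => ?_⟩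
  have h1 := dist_triangle_right x y v
  have h2 := hmax x hx
  have h3 := hmax y hy
  linarith

namespace SurfaceMesh

variable {Ω : Set E3} (M : SurfaceMesh Ω)

theorem diam_le_size {σ : Finset E3} (hσ : σ ∈ M.cells) :
    Metric.diam (σ : Set E3) ≤ M.size := by
  have := Finset.le_sup (f := fun σ : Finset E3 => (Metric.diam (σ : Set E3)).toNNReal) hσ
  refine (Real.le_coe_toNNReal _).trans ?_
  exact_mod_cast this

theorem diam_pos {σ : Finset E3} (hσ : σ ∈ M.cells) : 0 < Metric.diam (σ : Set E3) := by
  have hc : 1 < σ.card := by rcases M.card_cell σ hσ with h | h <;> omega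
  obtain ⟨a, ha, b, hb, hab⟩ := Finset.one_lt_card.1 hc
  exact (dist_pos.2 hab).trans_le (Metric.dist_le_diam_of_mem σ.finite_toSet.isBounded ha hb)

end SurfaceMesh

theorem cellCenter_sub {σ : Finset E3} (hσ : σ.Nonempty) (v : E3) :
    cellCenter σ - v = (σ.card : ℝ)⁻¹ • ∑ w ∈ σ, (w - v) := by
  have hc : (σ.card : ℝ) ≠ 0 := by exact_mod_cast hσ.card_pos.ne'
  rw [Finset.sum_sub_distrib, smul_sub, Finset.sum_const, ← Nat.cast_smul_eq_nsmul ℝ,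
    inv_smul_smul₀ hc, cellCenter]

theorem norm_cellCenter_sub_le {σ : Finset E3} {v : E3} (hv : v ∈ σ) :
    ‖cellCenter σ - v‖ ≤ Metric.diam (σ : Set E3) := by
  have hσ : σ.Nonempty := ⟨v, hv⟩
  have hc : (0 : ℝ) < σ.card := by exact_mod_cast hσ.card_pos
  rw [cellCenter_sub hσ, norm_smul, norm_inv, Real.norm_natCast]
  calc _ ≤ (σ.card : ℝ)⁻¹ * ∑ _w ∈ σ, Metric.diam (σ : Set E3) := by
        gcongr
        refine norm_sum_le_of_le _ fun w hw => ?_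
        rw [← dist_eq_norm]
        exact Metric.dist_le_diam_of_mem σ.finite_toSet.isBounded hw hv
    _ = _ := by
      rw [Finset.sum_const, nsmul_eq_mul]
      field_simp

/-- If `f` agrees up to `ε ‖y‖²` with a uniformly convex quadratic function of `y = A (w - v)`, then
this function takes at the cell center a value well below the mean of the nodal values of `f`. -/
theorem quadratic_cellCenter_le {σ : Finset E3} {v : E3} (hv : v ∈ σ) (hcard : σ.card ≤ 4)
    {f : E3 → ℝ} (A : E3 →L[ℝ] E2) (l : E2 →L[ℝ] ℝ) (K : E2 →L[ℝ] E2 →L[ℝ] ℝ) {C m ε : ℝ}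
    (hC : 0 < C) (hm : 0 < m) (hε : 0 ≤ ε) (hA : ‖A‖ ≤ C) (hK : ∀ y, m * ‖y‖ ^ 2 ≤ K y y)
    (hpos : 0 < Metric.diam (σ : Set E3))
    (hlow : ∀ w ∈ σ, ‖w - v‖ ≤ C * ‖A (w - v)‖)
    (hf : ∀ w ∈ σ, |f w - (f v + l (A (w - v)) + K (A (w - v)) (A (w - v)))|
      ≤ ε * ‖A (w - v)‖ ^ 2) :
    f v + l (A (cellCenter σ - v)) + K (A (cellCenter σ - v)) (A (cellCenter σ - v)) ≤
      linearValue f σ - (m / (32 * C ^ 2) - ε * C ^ 2) * Metric.diam (σ : Set E3) ^ 2 := by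
  have hσ : σ.Nonempty := ⟨v, hv⟩
  have hc : (0 : ℝ) < σ.card := by exact_mod_cast hσ.card_pos
  have hc4 : (σ.card : ℝ) ≤ 4 := by exact_mod_cast hcard
  set h := Metric.diam (σ : Set E3) with hh
  set y : E3 → E2 := fun w => A (w - v) with hy
  set b := A (cellCenter σ - v) with hb
  have hbmean : b = (σ.card : ℝ)⁻¹ • ∑ w ∈ σ, y w := by
    rw [hb, cellCenter_sub hσ, map_smul, map_sum]
  obtain ⟨w, hw, hwd⟩ := Finset.exists_diam_le_two_mul_dist hv
  rw [← hh] at hwd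
  have hwv : w ≠ v := by
    rintro rfl
    rw [dist_self] at hwd
    linarith
  have hgap := mean_sub_apply_mean_ge K hm.le hK σ y hbmean hw hv hwv
  have hyw : h / (2 * C) ≤ ‖y w - y v‖ := by
    have h1 := hlow w hw
    rw [dist_eq_norm] at hwd
    rw [show y w - y v = A (w - v) by simp [hy], div_le_iff₀ (by positivity)]
    linarith
  -- `32 = 2 · 4 · 2²`: at most four nodes, and a node at distance at least `h / 2` from `v`.
  have hgap' : m / (32 * C ^ 2) * h ^ 2
      ≤ (σ.card : ℝ)⁻¹ * ∑ w ∈ σ, K (y w) (y w) - K b b := by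
    refine le_trans ?_ hgap
    calc m / (32 * C ^ 2) * h ^ 2 = m / (2 * 4) * (h / (2 * C)) ^ 2 := by field_simp; norm_num
      _ ≤ _ := by gcongr
  have hbound : ∀ w ∈ σ, f v + l (y w) + K (y w) (y w) - ε * C ^ 2 * h ^ 2 ≤ f w := by
    intro w hw
    have h1 := (abs_le.1 (hf w hw)).1
    have h2 : ‖y w‖ ≤ C * h := by
      refine (A.le_of_opNorm_le hA _).trans ?_
      gcongr
      rw [← dist_eq_norm]
      exact Metric.dist_le_diam_of_mem σ.finite_toSet.isBounded hw hv
    have h3 : ε * ‖y w‖ ^ 2 ≤ ε * (C * h) ^ 2 := by gcongr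
    simp only [hy] at h3 ⊢
    linarith
  have hlin : (σ.card : ℝ)⁻¹ * ∑ w ∈ σ, (f v + l (y w) + K (y w) (y w) - ε * C ^ 2 * h ^ 2)
      ≤ linearValue f σ := by
    unfold linearValue
    gcongr with w hw
    exact hbound w hw
  have hl : (σ.card : ℝ)⁻¹ * ∑ w ∈ σ, l (y w) = l b := by
    rw [hbmean, map_smul, map_sum, smul_eq_mul]
  rw [Finset.sum_sub_distrib, Finset.sum_add_distrib, Finset.sum_add_distrib, Finset.sum_const,
    Finset.sum_const, nsmul_eq_mul, nsmul_eq_mul, mul_sub, mul_add, mul_add,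
    inv_mul_cancel_left₀ hc.ne', inv_mul_cancel_left₀ hc.ne', hl] at hlin
  linarith

theorem osus_neg_of_forall_lt {Ω : Set E3} {M : SurfaceMesh Ω} {S : FittingScheme M}
    {f : E3 → ℝ} {c : E3 → Fin 6 → ℝ} {σ : Finset E3} (hσ : σ.Nonempty)
    (h : ∀ v ∈ σ, quadEval (c v) (S.coord v (cellCenter σ)) < linearValue f σ) :
    osus S f c σ < 0 := by
  have hc : (0 : ℝ) < σ.card := by exact_mod_cast hσ.card_pos
  rw [osus, sub_neg, walfValue]
  calc _ < (σ.card : ℝ)⁻¹ * ∑ _v ∈ σ, linearValue f σ := by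
        gcongr
        exact h _ (by assumption)
    _ = _ := by
      rw [Finset.sum_const, nsmul_eq_mul, inv_mul_cancel_left₀ hc.ne']

/-! ### The sign of the indicator at a minimum -/

theorem osusNear_neg_of_isLocalMinOn {Ω : Set E3} (φ : G2Chart Ω) {s₀ : E2}
    (hs₀ : s₀ ∈ φ.source) {f : E3 → ℝ} (hf : ContDiffAt ℝ 2 (f ∘ φ.toFun) s₀)
    (hmin : IsLocalMinOn f Ω (φ.toFun s₀)) (hpos : ∀ ξ : E2, ξ ≠ 0 → 0 < φ.hessian f s₀ ξ) :
    OsusNear φ f (φ.toFun s₀) (fun α => α < 0) := by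
  have hgrad : fderiv ℝ (f ∘ φ.toFun) s₀ = 0 := by
    have hcont : ContinuousAt φ.toFun s₀ :=
      φ.contDiffOn.continuousOn.continuousAt (φ.isOpen_source.mem_nhds hs₀)
    refine IsLocalMin.fderiv_eq_zero ?_
    have htend : Filter.Tendsto φ.toFun (𝓝 s₀) (𝓝[Ω] (φ.toFun s₀)) := by
      refine tendsto_nhdsWithin_iff.2 ⟨hcont, ?_⟩
      filter_upwards [φ.isOpen_source.mem_nhds hs₀] with s hs
      exact (φ.image_source ▸ Set.mem_image_of_mem _ hs : φ.toFun s ∈ Ω ∩ φ.nbhd).1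
    exact htend.eventually hmin
  obtain ⟨r, hr, C, hC, m, hm, hexp⟩ := φ.exists_uniform_expansion hs₀ hf hgrad hpos
  refine ⟨Metric.ball (φ.toFun s₀) r, Metric.ball_mem_nhds _ hr, fun κ Γ => ?_⟩
  -- `ε * Q * h ^ 2` bounds the fitting error plus the expansion error at the nodes; `ε` makes it
  -- half of the convexity gap.
  set Q := 18 * |κ| * C ^ 2 * (Γ ^ 2 + 1) + C ^ 2 with hQ
  have hQ0 : 0 < Q := by positivity
  set ε := m / (64 * C ^ 2 * Q) with hε
  have hε0 : 0 < ε := by positivity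
  obtain ⟨η, hη, hexp⟩ := hexp ε hε0
  -- This threshold puts both the cell and the stencils of its nodes within `η` of each node.
  refine ⟨η / (1 + |Γ|), by positivity, fun M hM S htan hstab hcomp c hfit σ hσ hσU => ?_⟩
  have hd := (M.diam_le_size hσ).trans_lt hM
  have hdpos := M.diam_pos hσ
  set h := Metric.diam (σ : Set E3) with hh
  have hcard : σ.card ≤ 4 := by rcases M.card_cell σ hσ with h | h <;> omega
  have hne : σ.Nonempty := by
    rw [← Finset.card_pos]
    rcases M.card_cell σ hσ with h | h <;> omega
  rw [lt_div_iff₀ (by positivity)] at hd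
  refine osus_neg_of_forall_lt hne fun v hv => ?_
  have hvM : v ∈ M.nodes := ⟨σ, hσ, hv⟩
  have hvΩ : v ∈ Ω := M.cell_subset σ hσ hv
  obtain ⟨s, hs, hsv, hA, l, K, hK, hx⟩ := hexp v hvΩ (hσU hv)
  have hinj := φ.injective_fderiv s hs
  set A := leftPseudoInverse (fderiv ℝ φ.toFun s) with hAdef
  have hframe : ∀ i, S.frame v i ∈ LinearMap.range (fderiv ℝ φ.toFun s : E2 →ₗ[ℝ] E3) := by
    intro i
    have := htan s hs (by rwa [hsv]) (by rw [hsv]; exact hσU hv) i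
    rwa [hsv] at this
  have hcoord : ∀ x, A (frameSum (S.frame v) (S.coord v x)) = A (x - v) := fun x =>
    leftPseudoInverse_frameSum_localCoord hinj (S.orthonormal_frame v) hframe v x
  set T : E2 →ₗ[ℝ] E2 := (A : E3 →ₗ[ℝ] E2) ∘ₗ frameSum (S.frame v) with hT
  have hTcoord : ∀ x, T (S.coord v x) = A (x - v) := hcoord
  have hTnorm : ∀ u, ‖T u‖ ≤ C * ‖u‖ := by
    intro u
    rw [← norm_frameSum (S.orthonormal_frame v) u]
    exact A.le_of_opNorm_le hA _
  obtain ⟨t, ht0, ht⟩ := exists_quadEval_eq (f v) ((l : E2 →ₗ[ℝ] ℝ) ∘ₗ T)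
    ((ContinuousLinearMap.toLinearMap₁₂ K).compl₁₂ T T)
  have ht' : ∀ x, quadEval t (S.coord v x)
      = f v + l (A (x - v)) + K (A (x - v)) (A (x - v)) := by
    intro x
    rw [ht, ← hTcoord]
    rfl
  have hstencil : ∀ x ∈ S.stencil v, dist x v < η := by
    intro x hxs
    refine (hcomp σ hσ hσU v hv x hxs).trans_lt ?_
    rw [← hh]
    nlinarith [le_abs_self Γ]
  have hcell : ∀ w ∈ σ, dist w v < η := by
    intro w hw
    refine (Metric.dist_le_diam_of_mem σ.finite_toSet.isBounded hw hv).trans_lt ?_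
    rw [← hh]
    nlinarith [abs_nonneg Γ]
  have hradius : S.stencilRadius v ^ 2 ≤ Γ ^ 2 * h ^ 2 := by
    have h1 : S.stencilRadius v ≤ |Γ| * h := by
      have : (S.stencil v).sup (fun x => ‖S.coord v x‖₊) ≤ (|Γ| * h).toNNReal := by
        refine Finset.sup_le fun x hxs => ?_
        rw [← NNReal.coe_le_coe, coe_nnnorm, Real.coe_toNNReal _ (by positivity)]
        refine (norm_localCoord_le (S.orthonormal_frame v) v x).trans ?_
        rw [← dist_eq_norm]
        refine (hcomp σ hσ hσU v hv x hxs).trans ?_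
        rw [← hh]
        gcongr
        exact le_abs_self Γ
      have h2 := NNReal.coe_le_coe.2 this
      rwa [Real.coe_toNNReal _ (by positivity)] at h2
    have h0 : 0 ≤ S.stencilRadius v := NNReal.coe_nonneg _
    calc S.stencilRadius v ^ 2 ≤ (|Γ| * h) ^ 2 := by gcongr
      _ = _ := by rw [mul_pow, sq_abs]
  have hres : ∀ x ∈ S.stencil v,
      |quadEval t (S.coord v x) - f x| ≤ ε * C ^ 2 * ‖S.coord v x‖ ^ 2 := by
    intro x hxs
    -- A stencil node may belong to a cell that leaves `U`; the expansion only needs it to lie on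
    -- `Ω` within `η` of `v`.
    obtain ⟨τ, hτ, hxτ⟩ := S.stencil_subset v hvM hxs
    have h1 := (hx x (M.cell_subset τ hτ hxτ) (hstencil x hxs) _ rfl).2
    rw [abs_sub_comm, ht']
    refine h1.trans ?_
    rw [← hTcoord]
    calc ε * ‖T (S.coord v x)‖ ^ 2 ≤ ε * (C * ‖S.coord v x‖) ^ 2 := by
          gcongr
          exact hTnorm _
      _ = _ := by ring
  have hstable := (hfit v hvM).abs_sub_le (hstab v hvM (hσU hv)) ht0 (by positivity) hres
    (S.coord v (cellCenter σ))
  have hquad := quadratic_cellCenter_le hv hcard (f := f) A l K hC hm hε0.le hA hK hdpos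
    (fun w hw => (hx w (M.cell_subset σ hσ hw) (hcell w hw) _ rfl).1)
    (fun w hw => (hx w (M.cell_subset σ hσ hw) (hcell w hw) _ rfl).2)
  rw [← ht', ← hh] at hquad
  have hcenter : ‖S.coord v (cellCenter σ)‖ ^ 2 ≤ h ^ 2 := by
    gcongr
    exact (norm_localCoord_le (S.orthonormal_frame v) v _).trans (norm_cellCenter_sub_le hv)
  have herr : 18 * κ * (ε * C ^ 2) * (S.stencilRadius v ^ 2 + ‖S.coord v (cellCenter σ)‖ ^ 2)
      ≤ 18 * |κ| * (ε * C ^ 2) * (Γ ^ 2 * h ^ 2 + h ^ 2) := by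
    gcongr
    exact le_abs_self κ
  have hεQ : ε * Q = m / (64 * C ^ 2) := by
    rw [hε]
    field_simp
  have hdiff := (abs_le.1 hstable).2
  have hfinal : 18 * |κ| * (ε * C ^ 2) * (Γ ^ 2 * h ^ 2 + h ^ 2) + ε * C ^ 2 * h ^ 2
      = m / (64 * C ^ 2) * h ^ 2 := by
    rw [← hεQ, hQ]
    ring
  have hhalf : m / (32 * C ^ 2) = 2 * (m / (64 * C ^ 2)) := by
    field_simp
    norm_num
  have hgap : 0 < m / (64 * C ^ 2) * h ^ 2 := by positivity
  rw [hhalf] at hquad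
  linarith

/-! ### Maxima by change of sign -/

theorem quadEval_neg (c : Fin 6 → ℝ) (u : E2) : quadEval (-c) u = -quadEval c u := by
  simp [quadEval]

/-- Negating data and coefficients preserves residuals and exchanges the admissible sets. -/
theorem FittingScheme.IsWLSFit.neg {Ω : Set E3} {M : SurfaceMesh Ω} {S : FittingScheme M}
    {f : E3 → ℝ} {v : E3} {c : Fin 6 → ℝ} (h : S.IsWLSFit f v c) : S.IsWLSFit (-f) v (-c) := by
  have hres : ∀ c, S.residual (-f) v c = S.residual f v (-c) := by
    intro c
    refine Finset.sum_congr rfl fun x _ => ?_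
    rw [quadEval_neg, Pi.neg_apply]
    ring
  refine ⟨fun hk => by simp [h.1 hk], fun d hd => ?_⟩
  have hd' : -d ∈ S.admissible f v := fun hk => by
    have : d 0 = (-f) v := hd hk
    simp [this]
  simpa only [Set.mem_ofPred_eq, hres, neg_neg] using h.2 hd'

theorem osus_neg {Ω : Set E3} {M : SurfaceMesh Ω} (S : FittingScheme M) (f : E3 → ℝ)
    (c : E3 → Fin 6 → ℝ) (σ : Finset E3) :
    osus S (-f) (fun v => -c v) σ = -osus S f c σ := by
  simp only [osus, walfValue, linearValue, quadEval_neg, Pi.neg_apply, Finset.sum_neg_distrib]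
  ring

theorem OsusNear.pos_of_neg {Ω : Set E3} {φ : G2Chart Ω} {f : E3 → ℝ} {p : E3}
    (h : OsusNear φ (-f) p (fun α => α < 0)) : OsusNear φ f p (fun α => 0 < α) := by
  obtain ⟨U, hU, h⟩ := h
  refine ⟨U, hU, fun κ Γ => ?_⟩
  obtain ⟨h₀, hh₀, h⟩ := h κ Γ
  refine ⟨h₀, hh₀, fun M hM S htan hstab hcomp c hfit σ hσ hσU => ?_⟩
  have := h M hM S htan hstab hcomp (fun v => -c v) (fun v hv => (hfit v hv).neg) σ hσ hσU
  simpa [osus_neg] using this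

theorem G2Chart.hessian_neg {Ω : Set E3} (φ : G2Chart Ω) (f : E3 → ℝ) (s ξ : E2) :
    φ.hessian (-f) s ξ = -φ.hessian f s ξ := by
  have h1 : fderiv ℝ ((-f) ∘ φ.toFun) = -fderiv ℝ (f ∘ φ.toFun) := by
    funext t
    exact fderiv_neg
  rw [G2Chart.hessian, G2Chart.hessian, h1, fderiv_neg]
  simp

theorem proposition5 (Ω : Set E3) (φ : G2Chart Ω) (s₀ : E2) (hs₀ : s₀ ∈ φ.source)
    (f : E3 → ℝ) (hf : ContDiffAt ℝ 2 (f ∘ φ.toFun) s₀) :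
    (IsLocalMinOn f Ω (φ.toFun s₀) → (∀ ξ : E2, ξ ≠ 0 → 0 < φ.hessian f s₀ ξ) →
      OsusNear φ f (φ.toFun s₀) (fun α => α < 0)) ∧
    (IsLocalMaxOn f Ω (φ.toFun s₀) → (∀ ξ : E2, ξ ≠ 0 → φ.hessian f s₀ ξ < 0) →
      OsusNear φ f (φ.toFun s₀) (fun α => 0 < α)) := by
  refine ⟨osusNear_neg_of_isLocalMinOn φ hs₀ hf, fun hmax hneg => OsusNear.pos_of_neg ?_⟩
  refine osusNear_neg_of_isLocalMinOn φ hs₀ hf.neg hmax.neg fun ξ hξ => ?_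
  rw [G2Chart.hessian_neg]
  exact neg_pos.2 (hneg ξ hξ)
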